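/- Let $K$ be an algebraically closed field of characteristic zero, let $S_\bullet=K[z_0,z_1,z_2]$, and let $S^\bullet=K[y_0,y_1,y_2]$ act on $S_\bullet$ by contraction $s\mathbin{\lrcorner} f := s\!\left(\tfrac{\partial}{\partial z_0},\tfrac{\partial}{\partial z_1},\tfrac{\partial}{\partial z_2}\right)f$. Let $f\in S_\bullet$ be a homogeneous polynomial of degree $4$. The (Waring) rank $\operatorname{rk} f$ of $f$ is the least number $r$ such that $f$ is a sum of $r$ fourth powers of linear forms of $S_\bullet$. Suppose that there exist linear forms $x^0,x^1,l\in S^\bullet$ that are linearly dependent but pairwise linearly independent, such that $x^0x^1l\mathbin{\lrcorner} f=0$, while $(x^0)^2\mathbin{\lrcorner} f$, $(x^1)^2\mathbin{\lrcorner} f$ and $l^2\mathbin{\lrcorner} f$ are all nonzero. Then $\operatorname{rk} f\le 7$. -/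

import Mathlib

open MvPolynomial

noncomputable section

namespace Waring

variable {K : Type*} [Field K] {n : ℕ}

/-- The partial derivative `∂/∂xᵢ`, as a `K`-linear endomorphism of `K[x₁, …, xₙ]`. -/
def partialOp (K : Type*) [Field K] {n : ℕ} (i : Fin n) :
    Module.End K (MvPolynomial (Fin n) K) :=
  (pderiv i : Derivation K (MvPolynomial (Fin n) K) (MvPolynomial (Fin n) K)).toLinearMap

theorem partialOp_apply (i : Fin n) (f : MvPolynomial (Fin n) K) :
    partialOp K i f = pderiv i f := rfl

theorem partialOp_comm (i j : Fin n) :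
    partialOp K i * partialOp K j = partialOp K j * partialOp K i := by
  have h : ⁅(pderiv i : Derivation K (MvPolynomial (Fin n) K) (MvPolynomial (Fin n) K)),
      (pderiv j : Derivation K (MvPolynomial (Fin n) K) (MvPolynomial (Fin n) K))⁆ = 0 := by
    apply MvPolynomial.derivation_ext
    intro k
    simp [Derivation.commutator_apply, pderiv_X, Pi.single_apply, apply_ite]
  refine LinearMap.ext fun f => ?_
  have h' := congrArg (fun D => D f) h
  simp only [Derivation.commutator_apply, Derivation.zero_apply, sub_eq_zero] at h'
  exact h'

/-- The algebra of constant-coefficient differential operators on `K[x₁, …, xₙ]`. -/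
def diffOps (K : Type*) [Field K] (n : ℕ) :
    Subalgebra K (Module.End K (MvPolynomial (Fin n) K)) :=
  Algebra.adjoin K (Set.range (partialOp K (n := n)))

/-- Constant-coefficient differential operators commute. -/
instance diffOpsCommRing : CommRing (diffOps K n) :=
  { (diffOps K n).toRing with
    mul_comm := (Algebra.isMulCommutative_adjoin K (s := Set.range (partialOp K (n := n))) (by
      rintro _ ⟨i, rfl⟩ _ ⟨j, rfl⟩
      exact partialOp_comm i j)).is_comm.comm }

/-- The ring homomorphism `s ↦ s(∂/∂x₁, …, ∂/∂xₙ)` from the covariant polynomial ring to the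
constant-coefficient differential operators on the contravariant polynomial ring. -/
def toDiffOp : MvPolynomial (Fin n) K →ₐ[K] Module.End K (MvPolynomial (Fin n) K) :=
  (diffOps K n).val.comp
    (aeval fun i => (⟨partialOp K i, Algebra.subset_adjoin ⟨i, rfl⟩⟩ : diffOps K n))

theorem toDiffOp_X (i : Fin n) : toDiffOp (X i : MvPolynomial (Fin n) K) = partialOp K i := by
  simp [toDiffOp]

/-- The contraction `s ⌟ f` of `f` by `s`, that is, `s(∂/∂x₁, …, ∂/∂xₙ) f`. -/
def contract (s f : MvPolynomial (Fin n) K) : MvPolynomial (Fin n) K :=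
  toDiffOp s f

theorem contract_X (i : Fin n) (f : MvPolynomial (Fin n) K) :
    contract (X i) f = pderiv i f := by
  rw [contract, toDiffOp_X, partialOp_apply]

theorem contract_mul (s t f : MvPolynomial (Fin n) K) :
    contract (s * t) f = contract s (contract t f) := by
  simp [contract]

/-- The Waring rank of a form `f` of degree `d`: the least `r` such that `f` is a sum of `d`-th
powers of `r` linear forms (and `⊤` if there is no such `r`). -/
def waringRank (d : ℕ) (f : MvPolynomial (Fin n) K) : ℕ∞ :=
  sInf {m : ℕ∞ | ∃ r : ℕ, m = (r : ℕ∞) ∧ ∃ L : Fin r → MvPolynomial (Fin n) K,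
    (∀ i, (L i).IsHomogeneous 1) ∧ f = ∑ i, L i ^ d}

end Waring

end

/-! After rescaling, `l = x⁰ + x¹`. In coordinates `u, v, w` with `x⁰`, `x¹` acting as the
derivatives in `u`, `v`, the annihilation condition splits the quartic into binary quartics in `(A,
w)`, `(B, w)`, `(C, w)`, where `A = v`, `B = -u`, `C = u - v` are killed by `x⁰`, `x¹`, `l`
respectively. Since `A + B + C = 0`, the splitting is not unique: the coefficients `s₃` can be
shifted simultaneously, and the `s₄` can vary with constant sum.

The rank of each summand is controlled by Sylvester's method: coefficients obeying a linear
recurrence whose characteristic polynomial has distinct roots give a sum of that many powers. If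
`s₀s₂ - s₁² ≠ 0`, then for almost all `s₃` every `s₄` gives rank at most 3 and some `s₄` gives rank
at most 2. If the minor vanishes but `s₀ ≠ 0`, rank 1 occurs and 3 is never exceeded. Using the
freedom in the splitting, one reaches `7 = 2 + 2 + 3` or `7 = 1 + 3 + 3`.

If two summands have `s₀ = s₁ = 0`, they are regrouped to give `7 = 3 + 4`; the obstruction to this
is the vanishing of the square of one of the three operators on the quartic. -/

namespace Waring

/-- `f` is a sum of `r` `d`-th powers of linear forms. -/
def IsPowSum {K : Type*} [Field K] {n : ℕ} (d r : ℕ) (f : MvPolynomial (Fin n) K) : Prop :=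
  ∃ L : Fin r → MvPolynomial (Fin n) K, (∀ i, (L i).IsHomogeneous 1) ∧ f = ∑ i, L i ^ d

/-- The binary quartic in `u` and `v` with binomially normalised coefficients `s₀, …, s₄`. -/
noncomputable def binaryQuartic {K : Type*} [Field K] {n : ℕ} (s₀ s₁ s₂ s₃ s₄ : K)
    (u v : MvPolynomial (Fin n) K) : MvPolynomial (Fin n) K :=
  C s₀ * u ^ 4 + 4 * C s₁ * u ^ 3 * v + 6 * C s₂ * u ^ 2 * v ^ 2 + 4 * C s₃ * u * v ^ 3 +
    C s₄ * v ^ 4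

/-! ### Sylvester's method for binary quartics -/

section PowSum

variable {K : Type*} [Field K] {n : ℕ}

theorem IsPowSum.waringRank_le {d r : ℕ} {f : MvPolynomial (Fin n) K} (h : IsPowSum d r f) :
    waringRank d f ≤ r :=
  sInf_le ⟨r, rfl, h⟩

theorem IsPowSum.add {d r s : ℕ} {f g : MvPolynomial (Fin n) K} (hf : IsPowSum d r f)
    (hg : IsPowSum d s g) : IsPowSum d (r + s) (f + g) := by
  obtain ⟨L, hL, rfl⟩ := hf
  obtain ⟨M, hM, rfl⟩ := hg
  refine ⟨Fin.append L M, fun i => ?_, ?_⟩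
  · refine Fin.addCases (fun j => ?_) (fun j => ?_) i
    · simpa using hL j
    · simpa using hM j
  · simp [Fin.sum_univ_add]

theorem isPowSum_zero {d : ℕ} (hd : d ≠ 0) (r : ℕ) :
    IsPowSum d r (0 : MvPolynomial (Fin n) K) :=
  ⟨fun _ => 0, fun _ => isHomogeneous_zero _ _ _, by simp [hd]⟩

theorem IsPowSum.mono {d r s : ℕ} {f : MvPolynomial (Fin n) K} (hd : d ≠ 0)
    (hf : IsPowSum d r f) (hrs : r ≤ s) : IsPowSum d s f := by
  obtain ⟨k, rfl⟩ := Nat.exists_eq_add_of_le hrs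
  simpa using hf.add (isPowSum_zero hd k)

theorem isHomogeneous_add_C_mul {u v : MvPolynomial (Fin n) K} (hu : u.IsHomogeneous 1)
    (hv : v.IsHomogeneous 1) (c : K) : (u + C c * v).IsHomogeneous 1 := by
  simpa using hu.add ((isHomogeneous_C (Fin n) c).mul hv)

theorem binaryQuartic_swap (s₀ s₁ s₂ s₃ s₄ : K) (u v : MvPolynomial (Fin n) K) :
    binaryQuartic s₀ s₁ s₂ s₃ s₄ u v = binaryQuartic s₄ s₃ s₂ s₁ s₀ v u := by
  simp only [binaryQuartic]; ring

theorem binaryQuartic_add_last (s₀ s₁ s₂ s₃ s₄ t : K) (u v : MvPolynomial (Fin n) K) :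
    binaryQuartic s₀ s₁ s₂ s₃ (s₄ + t) u v = binaryQuartic s₀ s₁ s₂ s₃ s₄ u v + C t * v ^ 4 := by
  simp only [binaryQuartic, map_add]; ring

/-- When the minor vanishes, `s₀, s₁, s₂` form a geometric progression of ratio `σ = s₁ / s₀`, so
`s₀ (u + σ v)⁴` accounts for them and only `v³` terms remain. -/
theorem binaryQuartic_complete_power {s₀ : K} (s₁ s₂ s₃ s₄ : K) (h₀ : s₀ ≠ 0)
    (h : s₀ * s₂ - s₁ ^ 2 = 0) (u v : MvPolynomial (Fin n) K) :
    binaryQuartic s₀ s₁ s₂ s₃ s₄ u v =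
      binaryQuartic s₀ 0 0 (s₃ - s₁ ^ 3 / s₀ ^ 2)
        (s₄ - s₁ ^ 4 / s₀ ^ 3 - 4 * (s₃ - s₁ ^ 3 / s₀ ^ 2) * (s₁ / s₀)) (u + C (s₁ / s₀) * v) v := by
  obtain ⟨σ, rfl⟩ : ∃ σ, s₁ = s₀ * σ := ⟨s₁ / s₀, by field_simp⟩
  obtain rfl : s₂ = s₀ * σ ^ 2 := mul_left_cancel₀ h₀ (by linear_combination h)
  have e₁ : s₀ * σ / s₀ = σ := by field_simp
  have e₃ : (s₀ * σ) ^ 3 / s₀ ^ 2 = s₀ * σ ^ 3 := by field_simp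
  have e₄ : (s₀ * σ) ^ 4 / s₀ ^ 3 = s₀ * σ ^ 4 := by field_simp
  rw [e₁, e₃, e₄]
  simp only [binaryQuartic, map_sub, map_mul, map_pow, map_zero, map_ofNat]
  ring

theorem finite_quartic_roots {c₀ c₁ c₂ c₃ c₄ : K}
    (h : c₀ ≠ 0 ∨ c₁ ≠ 0 ∨ c₂ ≠ 0 ∨ c₃ ≠ 0 ∨ c₄ ≠ 0) :
    {t : K | c₀ + c₁ * t + c₂ * t ^ 2 + c₃ * t ^ 3 + c₄ * t ^ 4 = 0}.Finite := by
  let P : Polynomial K := ∑ i : Fin 5, Polynomial.monomial i (![c₀, c₁, c₂, c₃, c₄] i)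
  have hP : P ≠ 0 := by
    intro hP
    have hc (k : ℕ) : P.coeff k = 0 := by rw [hP, Polynomial.coeff_zero]
    have h₀ := hc 0
    have h₁ := hc 1
    have h₂ := hc 2
    have h₃ := hc 3
    have h₄ := hc 4
    simp [P, Fin.sum_univ_succ, Polynomial.coeff_monomial] at h₀ h₁ h₂ h₃ h₄
    tauto
  refine (Polynomial.finite_setOfPred_isRoot hP).subset fun t ht => ?_
  simp only [Set.mem_ofPred_eq] at ht
  simp [P, Fin.sum_univ_succ, Polynomial.eval_monomial]
  linear_combination ht

variable [IsAlgClosed K]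

theorem isPowSum_C_mul_pow {d : ℕ} (hd : 0 < d) (w : K) {u : MvPolynomial (Fin n) K}
    (hu : u.IsHomogeneous 1) : IsPowSum d 1 (C w * u ^ d) := by
  obtain ⟨κ, rfl⟩ := IsAlgClosed.exists_pow_nat_eq w hd
  refine ⟨fun _ => C κ * u, fun _ => by simpa using (isHomogeneous_C (Fin n) κ).mul hu, ?_⟩
  simp [mul_pow]

theorem exists_quadratic_roots (p₀ p₁ : K) : ∃ x y : K, x + y = -p₁ ∧ x * y = p₀ := by
  let P : Cubic K := ⟨0, 1, p₁, p₀⟩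
  have hdeg : P.toPoly.degree ≠ 0 := by
    rw [Cubic.degree_of_b_ne_zero rfl one_ne_zero]; decide
  obtain ⟨x, hx⟩ := IsAlgClosed.exists_root P.toPoly hdeg
  refine ⟨x, -p₁ - x, by ring, ?_⟩
  simp [P, Cubic.toPoly, Polynomial.IsRoot] at hx
  linear_combination -hx

theorem exists_cubic_roots (p₀ p₁ p₂ : K) : ∃ x y z : K, x + y + z = -p₂ ∧
    x * y + x * z + y * z = p₁ ∧ x * y * z = -p₀ := by
  let P : Cubic K := ⟨1, p₂, p₁, p₀⟩
  have hdeg : P.toPoly.degree ≠ 0 := by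
    rw [Cubic.degree_of_a_ne_zero one_ne_zero]; decide
  obtain ⟨x, hx⟩ := IsAlgClosed.exists_root P.toPoly hdeg
  simp [P, Cubic.toPoly, Polynomial.IsRoot] at hx
  obtain ⟨y, z, h₁, h₂⟩ := exists_quadratic_roots (p₁ + x * (p₂ + x)) (p₂ + x)
  refine ⟨x, y, z, by linear_combination h₁, by linear_combination x * h₁ + h₂, ?_⟩
  linear_combination x * h₂ + hx

variable {u v : MvPolynomial (Fin n) K}

/-- Sylvester's criterion for a binary quartic to be a sum of two fourth powers. -/
theorem isPowSum_two_of_recurrence (hu : u.IsHomogeneous 1) (hv : v.IsHomogeneous 1)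
    {s₀ s₁ s₂ s₃ s₄ p₀ p₁ : K} (hdisc : p₁ ^ 2 - 4 * p₀ ≠ 0)
    (h₀ : s₂ = -(p₀ * s₀ + p₁ * s₁)) (h₁ : s₃ = -(p₀ * s₁ + p₁ * s₂))
    (h₂ : s₄ = -(p₀ * s₂ + p₁ * s₃)) : IsPowSum 4 2 (binaryQuartic s₀ s₁ s₂ s₃ s₄ u v) := by
  obtain ⟨x, y, hs, hp⟩ := exists_quadratic_roots p₀ p₁
  have hxy : x - y ≠ 0 := fun h => hdisc (by
    linear_combination (x + y - p₁) * (-hs) - 4 * (-hp) + (x - y) * h)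
  obtain rfl : p₁ = -(x + y) := by rw [hs, neg_neg]
  subst hp
  -- The weights of the two nodes solve a Vandermonde system; the recurrence then propagates the
  -- formula to `s₂, s₃, s₄`.
  have key : ∃ a b : K, s₀ = a + b ∧ s₁ = a * x + b * y := by
    refine ⟨(s₁ - s₀ * y) / (x - y), (s₀ * x - s₁) / (x - y), ?_, ?_⟩ <;> field_simp <;> ring
  obtain ⟨a, b, rfl, rfl⟩ := key
  have e₂ : s₂ = a * x ^ 2 + b * y ^ 2 := by rw [h₀]; ring
  have e₃ : s₃ = a * x ^ 3 + b * y ^ 3 := by rw [h₁, e₂]; ring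
  have e₄ : s₄ = a * x ^ 4 + b * y ^ 4 := by rw [h₂, e₂, e₃]; ring
  have := (isPowSum_C_mul_pow four_pos a (isHomogeneous_add_C_mul hu hv x)).add
    (isPowSum_C_mul_pow four_pos b (isHomogeneous_add_C_mul hu hv y))
  convert this using 1
  simp only [binaryQuartic, e₂, e₃, e₄, map_add, map_mul, map_pow]
  ring

/-- Sylvester's criterion for a binary quartic to be a sum of three fourth powers. -/
theorem isPowSum_three_of_recurrence (hu : u.IsHomogeneous 1) (hv : v.IsHomogeneous 1)
    {s₀ s₁ s₂ s₃ s₄ : K} (p₀ p₁ p₂ : K) (hdisc : (⟨1, p₂, p₁, p₀⟩ : Cubic K).discr ≠ 0)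
    (h₀ : s₃ = -(p₀ * s₀ + p₁ * s₁ + p₂ * s₂)) (h₁ : s₄ = -(p₀ * s₁ + p₁ * s₂ + p₂ * s₃)) :
    IsPowSum 4 3 (binaryQuartic s₀ s₁ s₂ s₃ s₄ u v) := by
  obtain ⟨x, y, z, e₂, rfl, e₀⟩ := exists_cubic_roots p₀ p₁ p₂
  obtain rfl : p₂ = -(x + y + z) := by rw [e₂, neg_neg]
  obtain rfl : p₀ = -(x * y * z) := by rw [e₀, neg_neg]
  have hd : (x - y) ^ 2 * (x - z) ^ 2 * (y - z) ^ 2 ≠ 0 := by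
    convert hdisc using 1; simp only [Cubic.discr]; ring
  have hxy : x - y ≠ 0 := fun h => hd (by rw [h]; ring)
  have hxz : x - z ≠ 0 := fun h => hd (by rw [h]; ring)
  have hyz : y - z ≠ 0 := fun h => hd (by rw [h]; ring)
  have key : ∃ a b c : K, s₀ = a + b + c ∧ s₁ = a * x + b * y + c * z ∧
      s₂ = a * x ^ 2 + b * y ^ 2 + c * z ^ 2 := by
    refine ⟨(s₂ - (y + z) * s₁ + y * z * s₀) / ((x - y) * (x - z)),
      -(s₂ - (x + z) * s₁ + x * z * s₀) / ((x - y) * (y - z)),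
      (s₂ - (x + y) * s₁ + x * y * s₀) / ((x - z) * (y - z)), ?_, ?_, ?_⟩ <;>
    field_simp <;> ring
  obtain ⟨a, b, c, rfl, rfl, rfl⟩ := key
  have e₃ : s₃ = a * x ^ 3 + b * y ^ 3 + c * z ^ 3 := by rw [h₀]; ring
  have e₄ : s₄ = a * x ^ 4 + b * y ^ 4 + c * z ^ 4 := by rw [h₁, e₃]; ring
  have := ((isPowSum_C_mul_pow four_pos a (isHomogeneous_add_C_mul hu hv x)).add
    (isPowSum_C_mul_pow four_pos b (isHomogeneous_add_C_mul hu hv y))).add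
    (isPowSum_C_mul_pow four_pos c (isHomogeneous_add_C_mul hu hv z))
  convert this using 1
  simp only [binaryQuartic, e₃, e₄, map_add, map_mul, map_pow]
  ring

/-- Applied to discriminants: a recurrence with a free parameter `t` has distinct roots for some `t`
as soon as its discriminant is a nonzero polynomial in `t`. -/
theorem exists_quartic_ne_zero {c₀ c₁ c₂ c₃ c₄ : K}
    (h : c₀ ≠ 0 ∨ c₁ ≠ 0 ∨ c₂ ≠ 0 ∨ c₃ ≠ 0 ∨ c₄ ≠ 0) :
    ∃ t, c₀ + c₁ * t + c₂ * t ^ 2 + c₃ * t ^ 3 + c₄ * t ^ 4 ≠ 0 := by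
  have : Infinite K := IsAlgClosed.instInfinite
  exact (finite_quartic_roots h).exists_notMem

theorem exists_isPowSum_one (hu : u.IsHomogeneous 1) (hv : v.IsHomogeneous 1)
    {s₀ s₁ s₂ : K} (h₀ : s₀ ≠ 0) (h : s₀ * s₂ - s₁ ^ 2 = 0) :
    ∃ s₃ s₄, IsPowSum 4 1 (binaryQuartic s₀ s₁ s₂ s₃ s₄ u v) := by
  refine ⟨s₁ ^ 3 / s₀ ^ 2, s₁ ^ 4 / s₀ ^ 3, ?_⟩
  rw [binaryQuartic_complete_power s₁ s₂ _ _ h₀ h]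
  simpa [binaryQuartic] using
    isPowSum_C_mul_pow four_pos s₀ (isHomogeneous_add_C_mul hu hv (s₁ / s₀))

variable [CharZero K]

/-- If the two leading coefficients do not both vanish, the last one can be chosen so that the
quartic is a sum of three fourth powers. -/
theorem exists_isPowSum_three (hu : u.IsHomogeneous 1) (hv : v.IsHomogeneous 1)
    {s₀ s₁ : K} (s₂ s₃ : K) (h : s₀ ≠ 0 ∨ s₁ ≠ 0) :
    ∃ s₄, IsPowSum 4 3 (binaryQuartic s₀ s₁ s₂ s₃ s₄ u v) := by
  by_cases h₀ : s₀ = 0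
  · have h₁ : s₁ ≠ 0 := by tauto
    -- With `s₀ = 0` the first recurrence equation fixes `p₁` once `p₂ = 0`, leaving `p₀ = t` free;
    -- the second equation defines `s₄`.
    obtain ⟨t, ht⟩ := exists_quartic_ne_zero (c₀ := -4 * (-s₃ / s₁) ^ 3) (c₁ := 0) (c₂ := -27)
      (c₃ := 0) (c₄ := 0) (by simp)
    refine ⟨_, isPowSum_three_of_recurrence hu hv t (-s₃ / s₁) 0 ?_ ?_ rfl⟩
    · refine fun hd => ht (Eq.trans ?_ hd)
      rw [Cubic.discr]; ring
    · subst h₀; field_simp; ring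
  · obtain ⟨t, ht⟩ := exists_quartic_ne_zero (c₀ := -27 * (s₃ / s₀) ^ 2)
      (c₁ := -54 * (s₃ / s₀) * (s₁ / s₀)) (c₂ := -27 * (s₁ / s₀) ^ 2) (c₃ := -4) (c₄ := 0) (by simp)
    refine ⟨_, isPowSum_three_of_recurrence hu hv (-(s₃ / s₀ + t * (s₁ / s₀))) t 0 ?_ ?_ rfl⟩
    · refine fun hd => ht (Eq.trans ?_ hd)
      rw [Cubic.discr]; ring
    · field_simp; ring

theorem isPowSum_three_of_ne_zero (hu : u.IsHomogeneous 1) (hv : v.IsHomogeneous 1)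
    {s₂ : K} (s₃ s₄ : K) (h : s₂ ≠ 0) :
    IsPowSum 4 3 (binaryQuartic 0 0 s₂ s₃ s₄ u v) := by
  -- The two recurrence equations determine `p₂`, then `p₁`; `p₀ = t` does not enter them.
  obtain ⟨t, ht⟩ := exists_quartic_ne_zero
    (c₀ := (s₃ / s₂) ^ 2 * (((s₃ / s₂) * s₃ - s₄) / s₂) ^ 2 - 4 * (((s₃ / s₂) * s₃ - s₄) / s₂) ^ 3)
    (c₁ := 4 * (s₃ / s₂) ^ 3 - 18 * (s₃ / s₂) * (((s₃ / s₂) * s₃ - s₄) / s₂))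
    (c₂ := -27) (c₃ := 0) (c₄ := 0) (by simp)
  refine isPowSum_three_of_recurrence hu hv t (((s₃ / s₂) * s₃ - s₄) / s₂) (-(s₃ / s₂)) ?_ ?_ ?_
  · refine fun hd => ht (Eq.trans ?_ hd)
    rw [Cubic.discr]; ring
  · field_simp; ring
  · field_simp; ring

theorem isPowSum_three_of_hankel_eq_zero (hu : u.IsHomogeneous 1) (hv : v.IsHomogeneous 1)
    {s₀ s₁ s₂ : K} (s₃ s₄ : K) (h₀ : s₀ ≠ 0) (h : s₀ * s₂ - s₁ ^ 2 = 0) :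
    IsPowSum 4 3 (binaryQuartic s₀ s₁ s₂ s₃ s₄ u v) := by
  rw [binaryQuartic_complete_power s₁ s₂ s₃ s₄ h₀ h]
  have hu' := isHomogeneous_add_C_mul hu hv (s₁ / s₀)
  generalize u + C (s₁ / s₀) * v = u' at *
  generalize s₃ - s₁ ^ 3 / s₀ ^ 2 = x
  generalize s₄ - s₁ ^ 4 / s₀ ^ 3 - 4 * x * (s₁ / s₀) = y
  by_cases hx : x = 0
  · have := ((isPowSum_C_mul_pow four_pos s₀ hu').add (isPowSum_C_mul_pow four_pos y hv)).mono
      four_ne_zero (by norm_num : 1 + 1 ≤ 3)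
    convert this using 1
    simp [binaryQuartic, hx]
  · obtain ⟨t, ht⟩ := exists_quartic_ne_zero
      (c₀ := -4 * (y / x) ^ 3 * (x / s₀) - 27 * (x / s₀) ^ 2)
      (c₁ := 18 * (y / x) * (x / s₀)) (c₂ := (y / x) ^ 2) (c₃ := -4) (c₄ := 0) (by simp)
    refine isPowSum_three_of_recurrence hu' hv (-(x / s₀)) t (-(y / x)) ?_ ?_ ?_
    · refine fun hd => ht (Eq.trans ?_ hd)
      rw [Cubic.discr]; ring
    · field_simp; ring
    · field_simp; ring

/-- For all but finitely many values of `s₃`, a quartic whose leading Hankel minor does not vanish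
is a sum of three fourth powers, and of two for a suitable `s₄`. -/
theorem finite_exceptional_of_hankel_ne_zero (hu : u.IsHomogeneous 1) (hv : v.IsHomogeneous 1)
    {s₀ s₁ s₂ : K} (h : s₀ * s₂ - s₁ ^ 2 ≠ 0) :
    ∃ E : Set K, E.Finite ∧ ∀ s₃ ∉ E,
      (∃ s₄, IsPowSum 4 2 (binaryQuartic s₀ s₁ s₂ s₃ s₄ u v)) ∧
      ∀ s₄, IsPowSum 4 3 (binaryQuartic s₀ s₁ s₂ s₃ s₄ u v) := by
  -- The excluded values are the zeros in `s₃` of the numerator of the discriminant of the quadratic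
  -- recurrence, which Cramer's rule determines from `s₀, …, s₃`.
  refine ⟨_, finite_quartic_roots (c₀ := (s₁ * s₂) ^ 2 + 4 * s₂ ^ 2 * (s₀ * s₂ - s₁ ^ 2))
    (c₁ := -2 * s₀ * s₁ * s₂ - 4 * s₁ * (s₀ * s₂ - s₁ ^ 2)) (c₂ := s₀ ^ 2) (c₃ := 0) (c₄ := 0) ?_,
    fun s₃ hs₃ => ?_⟩
  · by_cases h₀ : s₀ = 0
    · subst h₀
      right; left
      simpa using h
    · right; right; left; simpa using h₀
  set q := s₀ * s₂ - s₁ ^ 2 with hq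
  have hdisc : ((s₁ * s₂ - s₀ * s₃) / q) ^ 2 - 4 * ((s₁ * s₃ - s₂ ^ 2) / q) ≠ 0 := by
    refine fun hd => hs₃ ?_
    field_simp at hd
    simp only [Set.mem_ofPred_eq]
    linear_combination hd
  constructor
  · refine ⟨_, isPowSum_two_of_recurrence hu hv hdisc ?_ ?_ rfl⟩
    · field_simp; rw [hq]; ring
    · field_simp; rw [hq]; ring
  · intro s₄
    generalize hQ₁ : (s₁ * s₂ - s₀ * s₃) / q = Q₁ at hdisc
    generalize hQ₀ : (s₁ * s₃ - s₂ ^ 2) / q = Q₀ at hdisc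
    generalize hα₁ : (s₁ * s₃ - s₀ * s₄) / q = α₁
    generalize hα₀ : (s₁ * s₄ - s₂ * s₃) / q = α₀
    -- The admissible cubics form the pencil `X³ + α₁X + α₀ + t(X² + Q₁X + Q₀)`; the `t⁴`
    -- coefficient of its discriminant is the discriminant of the quadratic, nonzero by `hdisc`.
    obtain ⟨t, ht⟩ := exists_quartic_ne_zero (c₀ := -4 * α₁ ^ 3 - 27 * α₀ ^ 2)
      (c₁ := -12 * α₁ ^ 2 * Q₁ - 54 * α₀ * Q₀ + 18 * α₁ * α₀)
      (c₂ := α₁ ^ 2 - 12 * α₁ * Q₁ ^ 2 - 27 * Q₀ ^ 2 + 18 * (α₁ * Q₀ + α₀ * Q₁))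
      (c₃ := 2 * α₁ * Q₁ - 4 * Q₁ ^ 3 - 4 * α₀ + 18 * Q₁ * Q₀) (c₄ := Q₁ ^ 2 - 4 * Q₀)
      (by tauto)
    refine isPowSum_three_of_recurrence hu hv (α₀ + t * Q₀) (α₁ + t * Q₁) t ?_ ?_ ?_
    · refine fun hd => ht (Eq.trans ?_ hd)
      rw [Cubic.discr]; ring
    · rw [← hα₀, ← hα₁, ← hQ₀, ← hQ₁]; field_simp; rw [hq]; ring
    · rw [← hα₀, ← hα₁, ← hQ₀, ← hQ₁]; field_simp; rw [hq]; ring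

theorem isPowSum_four_binaryQuartic (hu : u.IsHomogeneous 1) (hv : v.IsHomogeneous 1)
    (s₀ s₁ s₂ s₃ s₄ : K) : IsPowSum 4 4 (binaryQuartic s₀ s₁ s₂ s₃ s₄ u v) := by
  have key {u v : MvPolynomial (Fin n) K} (hu : u.IsHomogeneous 1) (hv : v.IsHomogeneous 1)
      {s₀ s₁ s₂ s₃ s₄ : K} (h : ∃ s₄, IsPowSum 4 3 (binaryQuartic s₀ s₁ s₂ s₃ s₄ u v)) :
      IsPowSum 4 4 (binaryQuartic s₀ s₁ s₂ s₃ s₄ u v) := by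
    obtain ⟨t, ht⟩ := h
    have := ht.add (isPowSum_C_mul_pow four_pos (s₄ - t) hv)
    rwa [← binaryQuartic_add_last, add_sub_cancel] at this
  by_cases h : s₀ ≠ 0 ∨ s₁ ≠ 0
  · exact key hu hv (exists_isPowSum_three hu hv s₂ s₃ h)
  push Not at h
  obtain ⟨rfl, rfl⟩ := h
  by_cases h₂ : s₂ = 0
  · subst h₂
    rw [binaryQuartic_swap]
    by_cases h' : s₄ ≠ 0 ∨ s₃ ≠ 0
    · exact key hv hu (exists_isPowSum_three hv hu 0 0 h')
    · push Not at h'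
      obtain ⟨rfl, rfl⟩ := h'
      simpa [binaryQuartic] using isPowSum_zero four_ne_zero 4
  · exact key hu hv ⟨0, isPowSum_three_of_ne_zero hu hv s₃ 0 h₂⟩

end PowSum

/-! ### Distributing the ranks among three families -/

section Families

variable {K : Type*} [Field K] {n : ℕ}

/-- `f` is the sum of three members of two-parameter families, where the first parameters may be
shifted simultaneously and the second ones vary with constant sum. -/
def IsSplitting (f : MvPolynomial (Fin n) K) (α β γ : K → K → MvPolynomial (Fin n) K) : Prop :=
  ∃ a b c e, ∀ t x y w, x + y + w = e → f = α (a + t) x + β (b + t) y + γ (c + t) w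

/-- A family of quartics whose general subfamilies contain a sum of two fourth powers and consist
of sums of three. -/
def IsGenericFamily (α : K → K → MvPolynomial (Fin n) K) : Prop :=
  ∃ E : Set K, E.Finite ∧ ∀ s ∉ E, (∃ x, IsPowSum 4 2 (α s x)) ∧ ∀ x, IsPowSum 4 3 (α s x)

/-- A family of quartics all of whose subfamilies contain a sum of three fourth powers. -/
def IsFlexibleFamily (α : K → K → MvPolynomial (Fin n) K) : Prop :=
  ∀ s, ∃ x, IsPowSum 4 3 (α s x)

/-- A family of sums of three fourth powers. -/
def IsTameFamily (α : K → K → MvPolynomial (Fin n) K) : Prop :=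
  ∀ s x, IsPowSum 4 3 (α s x)

/-- A family of quartics that contains a fourth power. -/
def IsDegenerateFamily (α : K → K → MvPolynomial (Fin n) K) : Prop :=
  ∃ s x, IsPowSum 4 1 (α s x)

/-- A family of quartics that has a subfamily of fourth powers. -/
def IsPowerFamily (α : K → K → MvPolynomial (Fin n) K) : Prop :=
  ∃ s, ∀ x, IsPowSum 4 1 (α s x)

/-- The possibilities for the family of quartics with fixed `s₀, s₁, s₂`, not both of `s₀, s₁`
being zero. -/
def IsHighFamily (α : K → K → MvPolynomial (Fin n) K) : Prop :=
  IsFlexibleFamily α ∧ (IsGenericFamily α ∨ IsDegenerateFamily α ∧ IsTameFamily α)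

variable {f : MvPolynomial (Fin n) K} {α β γ : K → K → MvPolynomial (Fin n) K}

theorem IsSplitting.swap (h : IsSplitting f α β γ) : IsSplitting f β α γ := by
  obtain ⟨a, b, c, e, h⟩ := h
  refine ⟨b, a, c, e, fun t x y w hs => ?_⟩
  rw [h t y x w (by rw [← hs]; ring)]; ring

theorem IsSplitting.rotate (h : IsSplitting f α β γ) : IsSplitting f β γ α := by
  obtain ⟨a, b, c, e, h⟩ := h
  refine ⟨b, c, a, e, fun t x y w hs => ?_⟩
  rw [h t w x y (by rw [← hs]; ring)]; ring

/-- Count `1 + 3 + 3`: the flexible families choose their second parameters, and the power family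
absorbs the constant-sum constraint. -/
theorem IsSplitting.isPowSum_of_isPowerFamily (h : IsSplitting f α β γ) (hα : IsPowerFamily α)
    (hβ : IsFlexibleFamily β) (hγ : IsFlexibleFamily γ) : IsPowSum 4 7 f := by
  obtain ⟨a, b, c, e, h⟩ := h
  obtain ⟨s, hs⟩ := hα
  obtain ⟨y, hy⟩ := hβ (b + (s - a))
  obtain ⟨w, hw⟩ := hγ (c + (s - a))
  rw [h (s - a) (e - y - w) y w (by ring), add_sub_cancel]
  exact ((hs _).add hy).add hw

theorem IsSplitting.isPowSum_of_isDegenerateFamily (h : IsSplitting f α β γ)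
    (hα : IsDegenerateFamily α) (hβ : IsFlexibleFamily β) (hγ : IsTameFamily γ) :
    IsPowSum 4 7 f := by
  obtain ⟨a, b, c, e, h⟩ := h
  obtain ⟨s, x, hs⟩ := hα
  obtain ⟨y, hy⟩ := hβ (b + (s - a))
  rw [h (s - a) x y (e - x - y) (by ring), add_sub_cancel]
  exact (hs.add hy).add (hγ _ _)

/-- Count `2 + 2 + 3`, at a common shift avoiding the three finite exceptional sets. -/
theorem IsSplitting.isPowSum_of_isGenericFamily [Infinite K] (h : IsSplitting f α β γ)
    (hα : IsGenericFamily α) (hβ : IsGenericFamily β) (hγ : IsGenericFamily γ ∨ IsTameFamily γ) :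
    IsPowSum 4 7 f := by
  obtain ⟨a, b, c, e, h⟩ := h
  obtain ⟨E₁, hE₁, h₁⟩ := hα
  obtain ⟨E₂, hE₂, h₂⟩ := hβ
  obtain ⟨E₃, hE₃, h₃⟩ : ∃ E : Set K, E.Finite ∧ ∀ s ∉ E, ∀ x, IsPowSum 4 3 (γ s x) := by
    rcases hγ with ⟨E, hE, h⟩ | hγ
    · exact ⟨E, hE, fun s hs => (h s hs).2⟩
    · exact ⟨∅, Set.finite_empty, fun s _ => hγ s⟩
  have hfin : ((a + ·) ⁻¹' E₁ ∪ (b + ·) ⁻¹' E₂ ∪ (c + ·) ⁻¹' E₃).Finite :=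
    ((hE₁.preimage (add_right_injective a).injOn).union
      (hE₂.preimage (add_right_injective b).injOn)).union
      (hE₃.preimage (add_right_injective c).injOn)
  obtain ⟨t, ht⟩ := hfin.exists_notMem
  simp only [Set.mem_union, Set.mem_preimage, not_or] at ht
  obtain ⟨x, hx⟩ := (h₁ _ ht.1.1).1
  obtain ⟨y, hy⟩ := (h₂ _ ht.1.2).1
  rw [h t x y (e - x - y) (by ring)]
  exact (hx.add hy).add (h₃ _ ht.2 _)

theorem IsSplitting.isPowSum_of_isTameFamily [Infinite K] (h : IsSplitting f α β γ)
    (hα : IsHighFamily α) (hβ : IsHighFamily β) (hγ : IsTameFamily γ) : IsPowSum 4 7 f := by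
  rcases hα.2 with hα' | hα'
  · rcases hβ.2 with hβ' | hβ'
    · exact h.isPowSum_of_isGenericFamily hα' hβ' (Or.inr hγ)
    · exact h.swap.isPowSum_of_isDegenerateFamily hβ'.1 hα.1 hγ
  · exact h.isPowSum_of_isDegenerateFamily hα'.1 hβ.1 hγ

theorem IsSplitting.isPowSum_of_isHighFamily [Infinite K] (h : IsSplitting f α β γ)
    (hα : IsHighFamily α) (hβ : IsHighFamily β) (hγ : IsHighFamily γ) : IsPowSum 4 7 f := by
  rcases hα.2 with hα' | hα'
  · rcases hβ.2 with hβ' | hβ'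
    · exact h.isPowSum_of_isGenericFamily hα' hβ' (hγ.2.imp_right And.right)
    · exact h.rotate.rotate.isPowSum_of_isTameFamily hγ hα hβ'.2
  · exact h.rotate.isPowSum_of_isTameFamily hβ hγ hα'.2

/-- The freedom comes from `4t(A + B + C)z³ = 0` and from moving multiples of `z⁴` between summands.
-/
theorem isSplitting_binaryQuartic {A B C z : MvPolynomial (Fin n) K} (h : A + B + C = 0)
    (a₀ a₁ a₂ a₃ a₄ b₀ b₁ b₂ b₃ b₄ c₀ c₁ c₂ c₃ c₄ : K) :
    IsSplitting (binaryQuartic a₀ a₁ a₂ a₃ a₄ A z + binaryQuartic b₀ b₁ b₂ b₃ b₄ B z +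
      binaryQuartic c₀ c₁ c₂ c₃ c₄ C z) (fun s x => binaryQuartic a₀ a₁ a₂ s x A z)
      (fun s x => binaryQuartic b₀ b₁ b₂ s x B z) (fun s x => binaryQuartic c₀ c₁ c₂ s x C z) := by
  refine ⟨a₃, b₃, c₃, a₄ + b₄ + c₄, fun t x y w hs => ?_⟩
  obtain rfl : w = a₄ + b₄ + c₄ - x - y := by rw [← hs]; ring
  obtain rfl : C = -A - B := by linear_combination h
  simp only [binaryQuartic, map_add, map_sub]
  ring

variable [IsAlgClosed K] [CharZero K] {u v : MvPolynomial (Fin n) K}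

theorem isHighFamily_binaryQuartic (hu : u.IsHomogeneous 1) (hv : v.IsHomogeneous 1)
    {s₀ s₁ : K} (s₂ : K) (h : s₀ ≠ 0 ∨ s₁ ≠ 0) :
    IsHighFamily fun s x => binaryQuartic s₀ s₁ s₂ s x u v := by
  refine ⟨fun s => exists_isPowSum_three hu hv s₂ s h, ?_⟩
  by_cases hq : s₀ * s₂ - s₁ ^ 2 = 0
  · have h₀ : s₀ ≠ 0 := by
      rintro rfl
      simp_all
    exact Or.inr ⟨exists_isPowSum_one hu hv h₀ hq,
      fun s x => isPowSum_three_of_hankel_eq_zero hu hv s x h₀ hq⟩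
  · exact Or.inl (finite_exceptional_of_hankel_ne_zero hu hv hq)

theorem isTameFamily_or_isPowerFamily_binaryQuartic (hu : u.IsHomogeneous 1)
    (hv : v.IsHomogeneous 1) (s₂ : K) :
    IsTameFamily (fun s x => binaryQuartic 0 0 s₂ s x u v) ∨
      IsPowerFamily (fun s x => binaryQuartic 0 0 s₂ s x u v) := by
  by_cases h : s₂ = 0
  · refine Or.inr ⟨0, fun x => ?_⟩
    simpa [binaryQuartic, h] using isPowSum_C_mul_pow four_pos x hv
  · exact Or.inl fun s x => isPowSum_three_of_ne_zero hu hv s x h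

/-- Completing the square: with `m = a₂ + b₂` and `κ = a₂ / m`, `a₂(B + C)² + b₂B²` equals `m(B +
κC)²` plus a multiple of `C²`. The two low quartics thus merge into one of rank at most 3, the rest
going into the quartic in `C, z`. -/
theorem isPowSum_of_two_low {A B C z : MvPolynomial (Fin n) K} (hB : B.IsHomogeneous 1)
    (hC : C.IsHomogeneous 1) (hz : z.IsHomogeneous 1) (h : A + B + C = 0) {a₂ b₂ : K}
    (hab : a₂ + b₂ ≠ 0) (a₃ a₄ b₃ b₄ c₀ c₁ c₂ c₃ c₄ : K) :
    IsPowSum 4 7 (binaryQuartic 0 0 a₂ a₃ a₄ A z + binaryQuartic 0 0 b₂ b₃ b₄ B z +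
      binaryQuartic c₀ c₁ c₂ c₃ c₄ C z) := by
  obtain ⟨κ, hκ⟩ : ∃ κ, a₂ = (a₂ + b₂) * κ := ⟨a₂ / (a₂ + b₂), by field_simp⟩
  obtain ⟨m, rfl⟩ : ∃ m, b₂ = m - a₂ := ⟨a₂ + b₂, by ring⟩
  rw [add_sub_cancel] at hκ hab
  subst hκ
  obtain rfl : A = -B - C := by linear_combination h
  have := (isPowSum_three_of_ne_zero (isHomogeneous_add_C_mul hB hC κ) hz (b₃ - a₃) (a₄ + b₄)
    hab).add (isPowSum_four_binaryQuartic hC hz c₀ c₁ (c₂ + m * κ - m * κ ^ 2)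
      (c₃ - (b₃ - a₃) * κ - a₃) c₄)
  convert this using 1
  simp only [binaryQuartic, map_add, map_sub, map_mul, map_pow, map_zero]
  ring

theorem isPowSum_seven_of_binaryQuartics {A B C z : MvPolynomial (Fin n) K}
    (hA : A.IsHomogeneous 1) (hB : B.IsHomogeneous 1) (hC : C.IsHomogeneous 1)
    (hz : z.IsHomogeneous 1) (h : A + B + C = 0)
    {a₀ a₁ a₂ a₃ a₄ b₀ b₁ b₂ b₃ b₄ c₀ c₁ c₂ c₃ c₄ : K}
    (hab : ¬ (a₀ = 0 ∧ a₁ = 0 ∧ b₀ = 0 ∧ b₁ = 0 ∧ a₂ + b₂ = 0))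
    (hbc : ¬ (b₀ = 0 ∧ b₁ = 0 ∧ c₀ = 0 ∧ c₁ = 0 ∧ b₂ + c₂ = 0))
    (hca : ¬ (c₀ = 0 ∧ c₁ = 0 ∧ a₀ = 0 ∧ a₁ = 0 ∧ c₂ + a₂ = 0)) :
    IsPowSum 4 7 (binaryQuartic a₀ a₁ a₂ a₃ a₄ A z + binaryQuartic b₀ b₁ b₂ b₃ b₄ B z +
      binaryQuartic c₀ c₁ c₂ c₃ c₄ C z) := by
  have hs := isSplitting_binaryQuartic (z := z) h a₀ a₁ a₂ a₃ a₄ b₀ b₁ b₂ b₃ b₄ c₀ c₁ c₂ c₃ c₄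
  have cases (x y : K) : (x ≠ 0 ∨ y ≠ 0) ∨ x = 0 ∧ y = 0 := by tauto
  have : Infinite K := IsAlgClosed.instInfinite
  rcases cases a₀ a₁ with ha | ⟨rfl, rfl⟩ <;> rcases cases b₀ b₁ with hb | ⟨rfl, rfl⟩
  · have ha := isHighFamily_binaryQuartic hA hz a₂ ha
    have hb := isHighFamily_binaryQuartic hB hz b₂ hb
    rcases cases c₀ c₁ with hc | ⟨rfl, rfl⟩
    · exact hs.isPowSum_of_isHighFamily ha hb (isHighFamily_binaryQuartic hC hz c₂ hc)
    · rcases isTameFamily_or_isPowerFamily_binaryQuartic hC hz c₂ with hc | hc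
      · exact hs.isPowSum_of_isTameFamily ha hb hc
      · exact hs.rotate.rotate.isPowSum_of_isPowerFamily hc ha.1 hb.1
  · have ha := isHighFamily_binaryQuartic hA hz a₂ ha
    rcases cases c₀ c₁ with hc | ⟨rfl, rfl⟩
    · have hc := isHighFamily_binaryQuartic hC hz c₂ hc
      rcases isTameFamily_or_isPowerFamily_binaryQuartic hB hz b₂ with hb | hb
      · exact hs.rotate.rotate.isPowSum_of_isTameFamily hc ha hb
      · exact hs.rotate.isPowSum_of_isPowerFamily hb hc.1 ha.1
    · rw [add_assoc, add_comm]
      exact isPowSum_of_two_low hC hA hz (by rw [← h]; ring) (by tauto) ..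
  · have hb := isHighFamily_binaryQuartic hB hz b₂ hb
    rcases cases c₀ c₁ with hc | ⟨rfl, rfl⟩
    · have hc := isHighFamily_binaryQuartic hC hz c₂ hc
      rcases isTameFamily_or_isPowerFamily_binaryQuartic hA hz a₂ with ha | ha
      · exact hs.rotate.isPowSum_of_isTameFamily hb hc ha
      · exact hs.isPowSum_of_isPowerFamily ha hb.1 hc.1
    · rw [add_right_comm]
      exact isPowSum_of_two_low hC hB hz (by rw [← h]; ring) (by rw [add_comm]; tauto) ..
  · exact isPowSum_of_two_low hB hC hz h (by tauto) ..

end Families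

/-! ### The splitting in dual coordinates -/

section Coordinates

variable {K : Type*} [Field K]

theorem eq_sum_antidiagonalTuple {R : Type*} [CommSemiring R] {n d : ℕ}
    {f : MvPolynomial (Fin n) R} (hf : f.IsHomogeneous d) :
    f = ∑ t ∈ Finset.Nat.antidiagonalTuple n d,
      C (coeff (Finsupp.equivFunOnFinite.symm t) f) * ∏ i, X i ^ t i := by
  have h (m : Fin n →₀ ℕ) (hm : m ∈ f.support) : ⇑m ∈ Finset.Nat.antidiagonalTuple n d := by
    rw [Finset.Nat.mem_antidiagonalTuple, ← Finsupp.degree_eq_sum]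
    by_contra h
    exact mem_support_iff.1 hm (hf.coeff_eq_zero h)
  conv_lhs => rw [f.as_sum]
  refine Finset.sum_bij_ne_zero (fun m _ _ => ⇑m) (fun m hm _ => h m hm)
    (fun _ _ _ _ _ _ h => DFunLike.coe_injective h) (fun t _ h => ?_) (fun m _ _ => ?_)
  · have ht : coeff (Finsupp.equivFunOnFinite.symm t) f ≠ 0 := by
      rintro h'
      exact h (by rw [h', C_0, zero_mul])
    exact ⟨Finsupp.equivFunOnFinite.symm t, mem_support_iff.2 ht, by simpa using ht, rfl⟩
  · rw [monomial_eq, Finsupp.prod_fintype _ _ (by simp)]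
    simp

theorem exists_ternaryQuartic_coeffs [CharZero K] {f : MvPolynomial (Fin 3) K}
    (hf : f.IsHomogeneous 4) :
    ∃ a b c p q r p' q' s p'' q'' t e g h : K,
      f = C a * X 0 ^ 4 + C (4 * p) * X 0 ^ 3 * X 1 + C (6 * q) * X 0 ^ 2 * X 1 ^ 2 +
        C (4 * r) * X 0 * X 1 ^ 3 + C b * X 1 ^ 4 +
        C (4 * p') * X 0 ^ 3 * X 2 + C (12 * q') * X 0 ^ 2 * X 1 * X 2 +
        C (12 * s) * X 0 * X 1 ^ 2 * X 2 + C (4 * p'') * X 1 ^ 3 * X 2 +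
        C (6 * q'') * X 0 ^ 2 * X 2 ^ 2 + C (12 * t) * X 0 * X 1 * X 2 ^ 2 +
        C (6 * e) * X 1 ^ 2 * X 2 ^ 2 + C (4 * g) * X 0 * X 2 ^ 3 + C (4 * h) * X 1 * X 2 ^ 3 +
        C c * X 2 ^ 4 := by
  have hl : List.Nat.antidiagonalTuple 3 4 = [![0, 0, 4], ![0, 1, 3], ![0, 2, 2], ![0, 3, 1],
    ![0, 4, 0], ![1, 0, 3], ![1, 1, 2], ![1, 2, 1], ![1, 3, 0], ![2, 0, 2], ![2, 1, 1], ![2, 2, 0],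
    ![3, 0, 1], ![3, 1, 0], ![4, 0, 0]] := by decide
  have hs := eq_sum_antidiagonalTuple hf
  obtain ⟨k, hk⟩ : ∃ k : (Fin 3 → ℕ) → K,
      k = fun t => coeff (Finsupp.equivFunOnFinite.symm t) f := ⟨_, rfl⟩
  have hs : f = ((List.Nat.antidiagonalTuple 3 4).map fun t => C (k t) * ∏ i, X i ^ t i).sum := by
    rw [hk]; exact hs
  rw [hl] at hs
  refine ⟨k ![4, 0, 0], k ![0, 4, 0], k ![0, 0, 4], k ![3, 1, 0] / 4, k ![2, 2, 0] / 6,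
    k ![1, 3, 0] / 4, k ![3, 0, 1] / 4, k ![2, 1, 1] / 12, k ![1, 2, 1] / 12, k ![0, 3, 1] / 4,
    k ![2, 0, 2] / 6, k ![1, 1, 2] / 12, k ![0, 2, 2] / 6, k ![1, 0, 3] / 4, k ![0, 1, 3] / 4, ?_⟩
  conv_lhs => rw [hs]
  have hdiv (m x : K) (hm : m ≠ 0) : m * (x / m) = x := mul_div_cancel₀ x hm
  rw [hdiv, hdiv, hdiv, hdiv, hdiv, hdiv, hdiv, hdiv, hdiv, hdiv, hdiv, hdiv]
  · simp only [List.map_cons, List.map_nil, List.sum_cons, List.sum_nil, Fin.prod_univ_three,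
      Matrix.cons_val]
    ring
  all_goals norm_num

theorem isPowSum_seven_of_dual [IsAlgClosed K] [CharZero K] {f : MvPolynomial (Fin 3) K}
    {n : ℕ} {F u v w : MvPolynomial (Fin n) K}
    (hf : f.IsHomogeneous 4) (hu : u.IsHomogeneous 1) (hv : v.IsHomogeneous 1)
    (hw : w.IsHomogeneous 1) (hF : F = aeval ![u, v, w] f)
    (D₀ D₁ D₂ : Derivation K (MvPolynomial (Fin n) K) (MvPolynomial (Fin n) K))
    (h₀u : D₀ u = 1) (h₀v : D₀ v = 0) (h₀w : D₀ w = 0)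
    (h₁u : D₁ u = 0) (h₁v : D₁ v = 1) (h₁w : D₁ w = 0)
    (h₂u : D₂ u = 0) (h₂v : D₂ v = 0) (h₂w : D₂ w = 1)
    (hann : D₀ (D₁ (D₀ F + D₁ F)) = 0) (hsq₀ : D₀ (D₀ F) ≠ 0) (hsq₁ : D₁ (D₁ F) ≠ 0)
    (hsq₂ : D₀ (D₀ F + D₁ F) + D₁ (D₀ F + D₁ F) ≠ 0) : IsPowSum 4 7 F := by
  obtain ⟨a, b, c, p, q, r, p', q', s, p'', q'', t, e, g, h, rfl⟩ := exists_ternaryQuartic_coeffs hf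
  simp only [map_add, map_mul (aeval _), map_pow (aeval _), aeval_X, aeval_C, algebraMap_eq,
    Matrix.cons_val] at hF
  have e₀ : D₀ F = C 4 * (C a * u ^ 3 + C (3 * p) * u ^ 2 * v + C (3 * q) * u * v ^ 2 +
      C r * v ^ 3 + C (3 * p') * u ^ 2 * w + C (6 * q') * u * v * w + C (3 * s) * v ^ 2 * w +
      C (3 * q'') * u * w ^ 2 + C (3 * t) * v * w ^ 2 + C g * w ^ 3) := by
    rw [hF]
    simp only [map_add D₀, Derivation.leibniz, Derivation.leibniz_pow, derivation_C, smul_eq_mul,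
      nsmul_eq_mul, h₀u, h₀v, h₀w]
    simp only [map_mul, map_ofNat]
    push_cast
    ring
  have e₁ : D₁ F = C 4 * (C p * u ^ 3 + C (3 * q) * u ^ 2 * v + C (3 * r) * u * v ^ 2 +
      C b * v ^ 3 + C (3 * q') * u ^ 2 * w + C (6 * s) * u * v * w + C (3 * p'') * v ^ 2 * w +
      C (3 * t) * u * w ^ 2 + C (3 * e) * v * w ^ 2 + C h * w ^ 3) := by
    rw [hF]
    simp only [map_add D₁, Derivation.leibniz, Derivation.leibniz_pow, derivation_C, smul_eq_mul,
      nsmul_eq_mul, h₁u, h₁v, h₁w]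
    simp only [map_mul, map_ofNat]
    push_cast
    ring
  have e₀₀ : D₀ (D₀ F) = C 12 * (C a * u ^ 2 + C (2 * p) * u * v + C q * v ^ 2 +
      C (2 * p') * u * w + C (2 * q') * v * w + C q'' * w ^ 2) := by
    rw [e₀]
    simp only [map_add D₀, Derivation.leibniz, Derivation.leibniz_pow, derivation_C, smul_eq_mul,
      nsmul_eq_mul, h₀u, h₀v, h₀w]
    simp only [map_mul, map_ofNat]
    push_cast
    ring
  have e₀₁ : D₀ (D₁ F) = C 12 * (C p * u ^ 2 + C (2 * q) * u * v + C r * v ^ 2 +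
      C (2 * q') * u * w + C (2 * s) * v * w + C t * w ^ 2) := by
    rw [e₁]
    simp only [map_add D₀, Derivation.leibniz, Derivation.leibniz_pow, derivation_C, smul_eq_mul,
      nsmul_eq_mul, h₀u, h₀v, h₀w]
    simp only [map_mul, map_ofNat]
    push_cast
    ring
  have e₁₀ : D₁ (D₀ F) = C 12 * (C p * u ^ 2 + C (2 * q) * u * v + C r * v ^ 2 +
      C (2 * q') * u * w + C (2 * s) * v * w + C t * w ^ 2) := by
    rw [e₀]
    simp only [map_add D₁, Derivation.leibniz, Derivation.leibniz_pow, derivation_C, smul_eq_mul,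
      nsmul_eq_mul, h₁u, h₁v, h₁w]
    simp only [map_mul, map_ofNat]
    push_cast
    ring
  have e₁₁ : D₁ (D₁ F) = C 12 * (C q * u ^ 2 + C (2 * r) * u * v + C b * v ^ 2 +
      C (2 * s) * u * w + C (2 * p'') * v * w + C e * w ^ 2) := by
    rw [e₁]
    simp only [map_add D₁, Derivation.leibniz, Derivation.leibniz_pow, derivation_C, smul_eq_mul,
      nsmul_eq_mul, h₁u, h₁v, h₁w]
    simp only [map_mul, map_ofNat]
    push_cast
    ring
  -- The third derivative of a quartic is a linear form; applying `D₀`, `D₁`, `D₂` to it reads off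
  -- its three coefficients.
  have hthird : C (24 * (p + q)) * u + C (24 * (q + r)) * v + C (24 * (q' + s)) * w = 0 := by
    rw [map_add D₁, e₁₀, e₁₁] at hann
    simp only [map_add D₀, Derivation.leibniz, Derivation.leibniz_pow, derivation_C, smul_eq_mul,
      nsmul_eq_mul, h₀u, h₀v, h₀w] at hann
    rw [← hann]
    simp only [map_mul, map_ofNat, map_add]
    push_cast
    ring
  have hp : p = -q := by
    have := congrArg D₀ hthird
    simp only [map_add D₀, Derivation.leibniz, derivation_C, smul_eq_mul, h₀u, h₀v, h₀w, map_zero,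
      mul_zero, mul_one, add_zero, C_eq_zero] at this
    linear_combination this / 24
  have hr : r = -q := by
    have := congrArg D₁ hthird
    simp only [map_add D₁, Derivation.leibniz, derivation_C, smul_eq_mul, h₁u, h₁v, h₁w, map_zero,
      mul_zero, mul_one, add_zero, zero_add, C_eq_zero] at this
    linear_combination this / 24
  have hs : s = -q' := by
    have := congrArg D₂ hthird
    simp only [map_add D₂, Derivation.leibniz, derivation_C, smul_eq_mul, h₂u, h₂v, h₂w, map_zero,
      mul_zero, mul_one, add_zero, zero_add, C_eq_zero] at this
    linear_combination this / 24
  subst hp hr hs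
  -- In each degree in `w`, the relations fix the mixed `u, v` terms up to a multiple of a power of
  -- `u - v`; what remains is pure in `u` and `v`. The terms in `w³` and `w⁴` are placed
  -- arbitrarily.
  have hsum : F = binaryQuartic (b - q) (p'' - q') (e + t) h c v w +
      binaryQuartic (a - q) (-(p' + q')) (q'' + t) (-g) 0 (-u) w +
      binaryQuartic q (-q') (-t) 0 0 (u - v) w := by
    rw [hF]
    simp only [binaryQuartic, map_add, map_sub, map_neg, map_mul, map_ofNat, map_zero]
    ring
  rw [hsum]
  refine isPowSum_seven_of_binaryQuartics hv hu.neg (hu.sub hv) hw (by ring) ?_ ?_ ?_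
  -- In each excluded case the operator killing the third linear form has vanishing square on `F`,
  -- since the other two summands contribute at most linearly along it.
  · rintro ⟨hb, hp'', ha, hp', ht⟩
    obtain rfl : b = q := by linear_combination hb
    obtain rfl : a = b := by linear_combination ha
    obtain rfl : p'' = q' := by linear_combination hp''
    obtain rfl : p' = -p'' := by linear_combination -hp'
    obtain rfl : e = -q'' - 2 * t := by linear_combination ht
    refine hsq₂ ?_
    rw [map_add, map_add, e₀₀, e₀₁, e₁₀, e₁₁]
    simp only [map_sub, map_neg, map_mul, map_ofNat]
    ring
  · rintro ⟨ha, hp', rfl, hq', ht⟩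
    obtain rfl : a = 0 := by linear_combination ha
    obtain rfl : q' = 0 := by linear_combination -hq'
    obtain rfl : p' = 0 := by linear_combination -hp'
    obtain rfl : q'' = 0 := by linear_combination ht
    exact hsq₀ (by rw [e₀₀]; simp)
  · rintro ⟨rfl, hq', hb, hp'', ht⟩
    obtain rfl : b = 0 := by linear_combination hb
    obtain rfl : q' = 0 := by linear_combination -hq'
    obtain rfl : p'' = 0 := by linear_combination hp''
    obtain rfl : e = 0 := by linear_combination ht
    exact hsq₁ (by rw [e₁₁]; simp)

end Coordinates

/-! ### From contraction to directional derivatives -/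

section Contraction

variable {K : Type*} [Field K] {n : ℕ}

/-- The derivation of `K[x₁, …, xₙ]` along a vector. -/
noncomputable def directional (c : Fin n → K) :
    Derivation K (MvPolynomial (Fin n) K) (MvPolynomial (Fin n) K) :=
  ∑ i, c i • pderiv i

theorem directional_apply (c : Fin n → K) (f : MvPolynomial (Fin n) K) :
    directional c f = ∑ i, c i • pderiv i f := by
  rw [directional, ← Derivation.coeFnAddMonoidHom_apply, map_sum, Finset.sum_apply]
  rfl

theorem directional_add (c d : Fin n → K) (f : MvPolynomial (Fin n) K) :
    directional (c + d) f = directional c f + directional d f := by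
  simp [directional_apply, add_smul, Finset.sum_add_distrib]

theorem contract_linear (c : Fin n → K) (f : MvPolynomial (Fin n) K) :
    contract (∑ i, c i • X i) f = directional c f := by
  simp [contract, directional_apply, toDiffOp_X, partialOp_apply]

theorem contract_smul (a : K) (s f : MvPolynomial (Fin n) K) :
    contract (a • s) f = a • contract s f := by
  simp [contract]

theorem directional_linear (c d : Fin n → K) :
    directional c (∑ j, d j • X j) = C (∑ j, c j * d j) := by
  rw [map_sum, map_sum]
  refine Finset.sum_congr rfl fun j _ => ?_
  rw [Derivation.map_smul, directional_apply, Finset.sum_eq_single j]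
  · rw [pderiv_X_self, smul_smul, mul_comm, smul_eq_C_mul, mul_one]
  · intro i _ hij
    rw [pderiv_X_of_ne hij.symm, smul_zero]
  · simp

theorem isHomogeneous_linear (d : Fin n → K) :
    (∑ j, d j • X j : MvPolynomial (Fin n) K).IsHomogeneous 1 :=
  IsHomogeneous.sum _ _ _ fun j _ => by
    rw [smul_eq_C_mul]; exact isHomogeneous_C_mul_X _ _

theorem IsHomogeneous.exists_eq_linear {x : MvPolynomial (Fin n) K} (hx : x.IsHomogeneous 1) :
    ∃ c : Fin n → K, x = ∑ i, c i • X i := by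
  have : x ∈ Submodule.span K (Set.range (X : Fin n → MvPolynomial (Fin n) K)) := by
    rw [← homogeneousSubmodule_one_eq_span_X]; exact hx
  obtain ⟨c, hc⟩ := (Submodule.mem_span_range_iff_exists_fun K).1 this
  exact ⟨c, hc.symm⟩

theorem isPowSum_seven_of_directional [IsAlgClosed K] [CharZero K] {f : MvPolynomial (Fin 3) K}
    (hf : f.IsHomogeneous 4) {a b : Fin 3 → K} (hab : LinearIndependent K ![a, b])
    (hann : directional a (directional b (directional (a + b) f)) = 0)
    (hsq₀ : directional a (directional a f) ≠ 0) (hsq₁ : directional b (directional b f) ≠ 0)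
    (hsq₂ : directional (a + b) (directional (a + b) f) ≠ 0) : IsPowSum 4 7 f := by
  -- Completing `a, b` to a basis, the columns of the inverse matrix give the dual linear forms, in
  -- which `f` is rewritten as `g`.
  obtain ⟨c, hc⟩ := exists_linearIndependent_snoc_of_lt_finrank hab (by simp)
  let V : Matrix (Fin 3) (Fin 3) K := Matrix.of ![a, b, c]
  have hV : LinearIndependent K V.row := by
    have : V.row = Fin.snoc ![a, b] c := by
      ext i j
      fin_cases i <;> rfl
    rwa [this]
  have hunit : IsUnit V.det :=
    (Matrix.isUnit_iff_isUnit_det V).1 (Matrix.linearIndependent_rows_iff_isUnit.1 hV)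
  have hVW := Matrix.mul_nonsing_inv V hunit
  have hWV := Matrix.nonsing_inv_mul V hunit
  generalize V⁻¹ = W at hVW hWV
  let u (j : Fin 3) : MvPolynomial (Fin 3) K := ∑ k, W k j • X k
  have hu (j) : (u j).IsHomogeneous 1 := isHomogeneous_linear _
  have hD (i j) : directional (V i) (u j) = C ((1 : Matrix (Fin 3) (Fin 3) K) i j) := by
    rw [directional_linear, ← hVW, Matrix.mul_apply]
  let g := aeval (fun k => ∑ j, V j k • (X j : MvPolynomial (Fin 3) K)) f
  have hg : g.IsHomogeneous 4 := by
    simpa using hf.aeval _ fun k => isHomogeneous_linear _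
  have hfg : f = aeval ![u 0, u 1, u 2] g := by
    have hu' : ![u 0, u 1, u 2] = u := by ext i; fin_cases i <;> rfl
    rw [hu', ← AlgHom.comp_apply]
    conv_lhs => rw [← aeval_X_left_apply f]
    congr 1
    ext1 k
    simp only [aeval_X, AlgHom.comp_apply, map_sum, map_smul, u, Finset.smul_sum, smul_smul]
    rw [Finset.sum_comm]
    have (m : Fin 3) : ∑ j, (V j k * W m j) • (X m : MvPolynomial (Fin 3) K) =
        (1 : Matrix (Fin 3) (Fin 3) K) m k • X m := by
      rw [← hWV, Matrix.mul_apply, Finset.sum_smul]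
      exact Finset.sum_congr rfl fun j _ => by rw [mul_comm]
    simp [this, Matrix.one_apply]
  have ea : V 0 = a := rfl
  have eb : V 1 = b := rfl
  rw [directional_add] at hann
  rw [directional_add, directional_add] at hsq₂
  refine isPowSum_seven_of_dual hg (hu 0) (hu 1) (hu 2) hfg (directional a) (directional b)
    (directional c) ?_ ?_ ?_ ?_ ?_ ?_ ?_ ?_ ?_ hann hsq₀ hsq₁ hsq₂
  · exact (hD 0 0).trans (by simp)
  · exact (hD 0 1).trans (by simp)
  · exact (hD 0 2).trans (by simp)
  · exact (hD 1 0).trans (by simp)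
  · exact (hD 1 1).trans (by simp)
  · exact (hD 1 2).trans (by simp)
  · exact (hD 2 0).trans (by simp)
  · exact (hD 2 1).trans (by simp)
  · exact (hD 2 2).trans (by simp)

end Contraction
end Waring

theorem mainTheorem4 {K : Type*} [Field K] [IsAlgClosed K] [CharZero K]
    (f : MvPolynomial (Fin 3) K) (hf : f.IsHomogeneous 4)
    (x₀ x₁ l : MvPolynomial (Fin 3) K)
    (hx₀ : x₀.IsHomogeneous 1) (hx₁ : x₁.IsHomogeneous 1) (hl : l.IsHomogeneous 1)
    (hdep : ¬ LinearIndependent K ![x₀, x₁, l])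
    (h01 : LinearIndependent K ![x₀, x₁])
    (h0l : LinearIndependent K ![x₀, l])
    (h1l : LinearIndependent K ![x₁, l])
    (hann : Waring.contract (x₀ * x₁ * l) f = 0)
    (hsq₀ : Waring.contract (x₀ ^ 2) f ≠ 0)
    (hsq₁ : Waring.contract (x₁ ^ 2) f ≠ 0)
    (hsql : Waring.contract (l ^ 2) f ≠ 0) :
    Waring.waringRank 4 f ≤ 7 := by
  obtain ⟨g, hg, hne⟩ := Fintype.not_linearIndependent_iff.1 hdep
  rw [LinearIndependent.pair_iff] at h01 h0l h1l
  simp only [Fin.sum_univ_three, Matrix.cons_val] at hg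
  -- Pairwise independence forces all three coefficients of the dependence to be nonzero.
  have hg₀ : g 0 ≠ 0 := by
    intro h
    rw [h, zero_smul, zero_add] at hg
    obtain ⟨h₁, h₂⟩ := h1l _ _ hg
    obtain ⟨i, hi⟩ := hne
    fin_cases i
    exacts [hi h, hi h₁, hi h₂]
  have hg₁ : g 1 ≠ 0 := by
    intro h
    rw [h, zero_smul, add_zero] at hg
    exact hg₀ (h0l _ _ hg).1
  have hg₂ : g 2 ≠ 0 := by
    intro h
    rw [h, zero_smul, add_zero] at hg
    exact hg₀ (h01 _ _ hg).1
  obtain ⟨a, ha⟩ := Waring.IsHomogeneous.exists_eq_linear hx₀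
  obtain ⟨b, hb⟩ := Waring.IsHomogeneous.exists_eq_linear hx₁
  have ha' : g 0 • x₀ = ∑ i, (g 0 • a) i • X i := by simp [ha, Finset.smul_sum, smul_smul]
  have hb' : g 1 • x₁ = ∑ i, (g 1 • b) i • X i := by simp [hb, Finset.smul_sum, smul_smul]
  -- Rescaling by the dependence coefficients makes the third operator the sum of the first two,
  -- without affecting the vanishing conditions.
  have hl' : (-g 2) • l = ∑ i, (g 0 • a + g 1 • b) i • X i := by
    have : (-g 2) • l = g 0 • x₀ + g 1 • x₁ := by
      rw [neg_smul]; linear_combination -hg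
    rw [this, ha', hb']
    simp only [Pi.add_apply, add_smul, Finset.sum_add_distrib]
  refine (Waring.isPowSum_seven_of_directional hf (a := g 0 • a) (b := g 1 • b)
    ?_ ?_ ?_ ?_ ?_).waringRank_le
  · rw [LinearIndependent.pair_iff]
    intro s t hst
    have := h01 (s * g 0) (t * g 1) (by
      rw [mul_smul, mul_smul, ha', hb', Finset.smul_sum, Finset.smul_sum, ← Finset.sum_add_distrib]
      refine Finset.sum_eq_zero fun i _ => ?_
      rw [smul_smul, smul_smul, ← add_smul]
      have := congrFun hst i
      simp only [Pi.add_apply, Pi.smul_apply s, Pi.smul_apply t, smul_eq_mul s,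
        smul_eq_mul t, Pi.zero_apply] at this
      rw [this, zero_smul])
    simpa [hg₀, hg₁] using this
  all_goals
    simp only [← Waring.contract_linear, ← ha', ← hb', ← hl', ← Waring.contract_mul]
    simp only [smul_mul_smul_comm, ← sq, smul_pow, ← mul_assoc, Waring.contract_smul]
  · rw [hann, smul_zero]
  · exact smul_ne_zero (pow_ne_zero 2 hg₀) hsq₀
  · exact smul_ne_zero (pow_ne_zero 2 hg₁) hsq₁
  · exact smul_ne_zero (pow_ne_zero 2 (neg_ne_zero.2 hg₂)) hsql
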